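/- Let $X$ be a metric space. A contour of a function $f\colon X\to\mathbb R$ is a connected component of a level set $f^{-1}(y)$, $y\in\mathbb R$. The Reeb graph $R_f$ is the quotient of $X$ by the relation of belonging to the same contour of $f$, and $\varphi\colon X\to R_f$ is the quotient map. If $X$ contains a homeomorphic (not necessarily isometric) image of $\mathbb R^2$, then there is a real number $b=b(X)>0$, depending only on $X$, such that every continuous function $f\colon X\to\mathbb R$ has a contour $C$ with $$\operatorname{diam}(C)\ge b,$$ where the diameter may be infinite. Consequently, for every continuous $f\colon X\to\mathbb R$ and every metric (or merely pseudometric) $d_{R_f}$ on $R_f$, the distortion of the Reeb quotient map satisfies $$\operatorname{dis}(\varphi)=\sup_{x,x'\in X}\bigl|d_X(x,x')-d_{R_f}(\varphi(x),\varphi(x'))\bigr|\ge b.$$ The hypothesis holds, for example, if $X$ is nonempty and is a topological manifold (without boundary) of dimension $n\ge 2$, in particular if $X$ is an $n$-dimensional connected Riemannian manifold with its distance function. -/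

import Mathlib

open scoped ENNReal

/-- A contour of `f`: a connected component of a level set `f⁻¹(y)`. -/
def IsContour {X Y : Type*} [TopologicalSpace X] (f : X → Y) (C : Set X) : Prop :=
  ∃ y : Y, ∃ x ∈ f ⁻¹' {y}, C = connectedComponentIn (f ⁻¹' {y}) x

/-- Two contours with a common point coincide. -/
theorem IsContour.eq_of_mem {X Y : Type*} [TopologicalSpace X] {f : X → Y} {C D : Set X} {z : X}
    (hC : IsContour f C) (hD : IsContour f D) (hzC : z ∈ C) (hzD : z ∈ D) : C = D := by
  obtain ⟨y, x, -, rfl⟩ := hC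
  obtain ⟨y', x', -, rfl⟩ := hD
  have h : f z = y := connectedComponentIn_subset (f ⁻¹' {y}) x hzC
  have h' : f z = y' := connectedComponentIn_subset (f ⁻¹' {y'}) x' hzD
  have hy : y = y' := h.symm.trans h'
  subst hy
  rw [connectedComponentIn_eq hzC, connectedComponentIn_eq hzD]

/-- The relation "`x` and `x'` belong to the same contour of `f`". -/
def reebSetoid {X Y : Type*} [TopologicalSpace X] (f : X → Y) : Setoid X where
  r x x' := ∃ C : Set X, IsContour f C ∧ x ∈ C ∧ x' ∈ C
  iseqv :=
    { refl := fun x =>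
        ⟨connectedComponentIn (f ⁻¹' {f x}) x, ⟨f x, x, rfl, rfl⟩,
          mem_connectedComponentIn rfl, mem_connectedComponentIn rfl⟩
      symm := fun ⟨C, hC, hx, hx'⟩ => ⟨C, hC, hx', hx⟩
      trans := fun ⟨C, hC, hx, hy⟩ ⟨_, hD, hy', hz⟩ =>
        ⟨C, hC, hx, (hC.eq_of_mem hD hy hy') ▸ hz⟩ }

/-- The Reeb graph (Reeb quotient space) of `f`. -/
def ReebGraph {X Y : Type*} [TopologicalSpace X] (f : X → Y) : Type _ :=
  Quotient (reebSetoid f)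

/-- The Reeb graph carries the quotient topology. -/
instance {X Y : Type*} [TopologicalSpace X] (f : X → Y) : TopologicalSpace (ReebGraph f) :=
  inferInstanceAs (TopologicalSpace (Quotient (reebSetoid f)))

/-- The Reeb quotient map of `f`. -/
def reebMap {X Y : Type*} [TopologicalSpace X] (f : X → Y) : X → ReebGraph f :=
  Quotient.mk (reebSetoid f)

/-- The distortion `sup |d(x, x') - d(φ x, φ x')|` of a map, with values in `[0, ∞]`. -/
noncomputable def distortion {X Y : Type*} [PseudoMetricSpace X] [PseudoMetricSpace Y]
    (φ : X → Y) : ℝ≥0∞ :=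
  ⨆ (x : X) (x' : X), ENNReal.ofReal |dist x x' - dist (φ x) (φ x')|

/-- `X` has a subspace homeomorphic to the plane `ℝ²`. -/
def ContainsPlane (X : Type*) [TopologicalSpace X] : Prop :=
  ∃ U : Set X, Nonempty (EuclideanSpace ℝ (Fin 2) ≃ₜ U)

/-! The core is a fact about the unit square (`exists_level_component_meeting_sides`): some
component of a level set of `F` meets the left edge, the bottom edge and the union of the other two.
Otherwise each component can be coloured by a side it misses. By compactness this colouring extends
to thin bands of values of `F`, so that close points of one band share a colour. Sperner's lemma
(`exists_rainbow_triangle`) yields three close points of distinct colours, hence in three distinct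
bands, although close points lie in equal or adjacent bands.

The three sides have no common point, so by compactness a set meeting their images under an
embedding in `X` has diameter at least some `b > 0` that does not depend on `f`. A contour is
collapsed to one point of the Reeb graph, so its diameter bounds the distortion. -/

/-! ### Sperner's lemma on a grid -/

/-- The signed count of passages from colour `0` to colour `1` along an edge. -/
def colourChange (a b : Fin 3) : ℤ :=
  if a = 0 ∧ b = 1 then 1 else if a = 1 ∧ b = 0 then -1 else 0

/-- Around a triangle that is not rainbow the changes cancel, as for a discrete gradient. -/
theorem colourChange_triangle :
    ∀ a b d : Fin 3, (a = b ∨ b = d ∨ a = d) →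
      colourChange a b + colourChange b d = colourChange a d := by
  decide

theorem colourChange_eq_zero_of_ne_zero :
    ∀ a b : Fin 3, a ≠ 0 → b ≠ 0 → colourChange a b = 0 := by
  decide

theorem colourChange_eq_zero_of_ne_one :
    ∀ a b : Fin 3, a ≠ 1 → b ≠ 1 → colourChange a b = 0 := by
  decide

/-- Makes the changes telescope along an edge without colour `2`. -/
theorem colourChange_eq_sub_of_ne_two :
    ∀ a b : Fin 3, a ≠ 2 → b ≠ 2 → colourChange a b = (b : ℤ) - a := by
  decide

/-- Sperner's lemma on a triangulated square: a colouring of the grid avoiding colour `0` on the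
left edge, colour `1` on the bottom edge and colour `2` on the other two edges has a triangle of
the triangulation with three different colours. -/
theorem exists_rainbow_triangle (c : ℕ → ℕ → Fin 3) (n : ℕ)
    (left : ∀ j ≤ n, c 0 j ≠ 0) (bottom : ∀ i ≤ n, c i 0 ≠ 1)
    (top : ∀ i ≤ n, c i n ≠ 2) (right : ∀ j ≤ n, c n j ≠ 2) :
    ∃ i < n, ∃ j < n, ∃ b, (b = c (i + 1) j ∨ b = c i (j + 1)) ∧
      c i j ≠ b ∧ b ≠ c (i + 1) (j + 1) ∧ c i j ≠ c (i + 1) (j + 1) := by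
  by_contra! h
  -- Both ways around a cell agree with its diagonal.
  have cell : ∀ i < n, ∀ j < n,
      colourChange (c i j) (c (i + 1) j) + colourChange (c (i + 1) j) (c (i + 1) (j + 1)) =
        colourChange (c i j) (c i (j + 1)) + colourChange (c i (j + 1)) (c (i + 1) (j + 1)) := by
    intro i hi j hj
    have key : ∀ b, (b = c (i + 1) j ∨ b = c i (j + 1)) →
        colourChange (c i j) b + colourChange b (c (i + 1) (j + 1)) =
          colourChange (c i j) (c (i + 1) (j + 1)) := by
      intro b hb
      apply colourChange_triangle
      have := h i hi j hj b hb
      tauto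
    rw [key _ (Or.inl rfl), key _ (Or.inr rfl)]
  have row : ∀ j < n, ∀ m ≤ n,
      ∑ i ∈ Finset.range m, colourChange (c i j) (c (i + 1) j) +
          colourChange (c m j) (c m (j + 1)) =
        colourChange (c 0 j) (c 0 (j + 1)) +
          ∑ i ∈ Finset.range m, colourChange (c i (j + 1)) (c (i + 1) (j + 1)) := by
    intro j hj m
    induction m with
    | zero => simp
    | succ m ih =>
      intro hm
      have h1 := ih (by omega)
      have h2 := cell m (by omega) j hj
      rw [Finset.sum_range_succ, Finset.sum_range_succ]
      linarith
  have square : ∀ m ≤ n,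
      ∑ i ∈ Finset.range n, colourChange (c i 0) (c (i + 1) 0) +
          ∑ j ∈ Finset.range m, colourChange (c n j) (c n (j + 1)) =
        ∑ j ∈ Finset.range m, colourChange (c 0 j) (c 0 (j + 1)) +
          ∑ i ∈ Finset.range n, colourChange (c i m) (c (i + 1) m) := by
    intro m
    induction m with
    | zero => simp
    | succ m ih =>
      intro hm
      have h1 := ih (by omega)
      have h2 := row m (by omega) n le_rfl
      rw [Finset.sum_range_succ, Finset.sum_range_succ]
      linarith
  have total := square n le_rfl
  have hbottom : ∑ i ∈ Finset.range n, colourChange (c i 0) (c (i + 1) 0) = 0 :=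
    Finset.sum_eq_zero fun i hi => by
      have := Finset.mem_range.mp hi
      exact colourChange_eq_zero_of_ne_one _ _ (bottom i (by omega)) (bottom (i + 1) (by omega))
  have hleft : ∑ j ∈ Finset.range n, colourChange (c 0 j) (c 0 (j + 1)) = 0 :=
    Finset.sum_eq_zero fun j hj => by
      have := Finset.mem_range.mp hj
      exact colourChange_eq_zero_of_ne_zero _ _ (left j (by omega)) (left (j + 1) (by omega))
  have hright : ∑ j ∈ Finset.range n, colourChange (c n j) (c n (j + 1)) =
      (c n n : ℤ) - (c n 0 : ℤ) := by
    rw [← Finset.sum_range_sub (fun j => ((c n j : Fin 3) : ℤ))]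
    refine Finset.sum_congr rfl fun j hj => ?_
    have := Finset.mem_range.mp hj
    exact colourChange_eq_sub_of_ne_two _ _ (right j (by omega)) (right (j + 1) (by omega))
  have htop : ∑ i ∈ Finset.range n, colourChange (c i n) (c (i + 1) n) =
      (c n n : ℤ) - (c 0 n : ℤ) := by
    rw [← Finset.sum_range_sub (fun i => ((c i n : Fin 3) : ℤ))]
    refine Finset.sum_congr rfl fun i hi => ?_
    have := Finset.mem_range.mp hi
    exact colourChange_eq_sub_of_ne_two _ _ (top i (by omega)) (top (i + 1) (by omega))
  have corner : c n 0 = c 0 n := by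
    apply Fin.ext
    have : (c n 0 : ℤ) = (c 0 n : ℤ) := by linarith
    exact_mod_cast this
  -- The corner `(n, 0)` can only have colour `0`, which is forbidden at `(0, n)`.
  have h1 := left n le_rfl
  have h2 := bottom n le_rfl
  have h3 := right 0 (Nat.zero_le n)
  rw [← corner] at h1
  revert h1 h2 h3
  generalize c n 0 = a
  revert a
  decide

/-! ### Splitting level sets by colour -/

/-- If each connected component of a compact Hausdorff space misses one of a family of
closed sets, then that set can be chosen in a locally constant way. -/
theorem exists_continuous_avoiding {K ι : Type*} [TopologicalSpace K] [CompactSpace K] [T2Space K]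
    [Nonempty ι] [TopologicalSpace ι] (S : ι → Set K) (hS : ∀ i, IsClosed (S i))
    (h : ∀ x, ∃ i, Disjoint (connectedComponent x) (S i)) :
    ∃ c : K → ι, Continuous c ∧ ∀ x, x ∉ S (c x) := by
  classical
  suffices H : ∃ V : Set K, IsClopen V ∧ Set.univ ⊆ V ∧
      ∃ c : K → ι, Continuous c ∧ ∀ x ∈ V, x ∉ S (c x) by
    obtain ⟨V, -, hV, c, hc, hcV⟩ := H
    exact ⟨c, hc, fun x => hcV x (hV trivial)⟩
  -- Local choices are glued piecewise; `V` is clopen so that gluing preserves continuity.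
  refine isCompact_univ.induction_on
    (p := fun s => ∃ V : Set K, IsClopen V ∧ s ⊆ V ∧
      ∃ c : K → ι, Continuous c ∧ ∀ x ∈ V, x ∉ S (c x)) ?_ ?_ ?_ ?_
  · exact ⟨∅, isClopen_empty, subset_rfl, fun _ => Classical.arbitrary ι, continuous_const,
      fun x hx => hx.elim⟩
  · rintro s t hst ⟨V, hV, htV, H⟩
    exact ⟨V, hV, hst.trans htV, H⟩
  · rintro s t ⟨V, hV, hsV, c, hc, hcV⟩ ⟨W, hW, htW, d, hd, hdW⟩
    refine ⟨V ∪ W, hV.union hW, Set.union_subset_union hsV htW, V.piecewise c d,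
      hc.piecewise (by simp [hV.frontier_eq]) hd, fun x hx => ?_⟩
    by_cases hxV : x ∈ V
    · simpa [Set.piecewise, hxV] using hcV x hxV
    · simpa [Set.piecewise, hxV] using hdW x (hx.resolve_left hxV)
  · intro x _
    obtain ⟨i, hi⟩ := h x
    -- By compactness, one clopen neighbourhood of `x` already misses `S i`.
    rw [connectedComponent_eq_iInter_isClopen] at hi
    have : ∃ Z : {s : Set K // IsClopen s ∧ x ∈ s}, (Z : Set K) ⊆ (S i)ᶜ := by
      have : Nonempty {s : Set K // IsClopen s ∧ x ∈ s} := ⟨⟨Set.univ, isClopen_univ, trivial⟩⟩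
      refine exists_subset_nhds_of_compactSpace (fun A B => ?_) (fun Z => Z.2.1.1)
        fun y hy => (hS i).isOpen_compl.mem_nhds (Set.disjoint_left.mp hi hy)
      exact ⟨⟨A ∩ B, A.2.1.inter B.2.1, A.2.2, B.2.2⟩, Set.inter_subset_left,
        Set.inter_subset_right⟩
    obtain ⟨Z, hZ⟩ := this
    exact ⟨Z, mem_nhdsWithin_of_mem_nhds (Z.2.1.2.mem_nhds Z.2.2), Z, Z.2.1, subset_rfl,
      fun _ => i, continuous_const, fun y hy => hZ hy⟩

/-- If each component of a level set in `Q` misses one of three closed sets, then a neighbourhood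
of that level set splits into three disjoint open parts, each of which misses one of them. -/
theorem exists_open_partition_near_level {α : Type*} [MetricSpace α] {Q : Set α} (hQ : IsCompact Q)
    {F : α → ℝ} (hF : Continuous F) (S : Fin 3 → Set α) (hS : ∀ i, IsClosed (S i)) (y : ℝ)
    (h : ∀ x ∈ Q ∩ F ⁻¹' {y}, ∃ i, Disjoint (connectedComponentIn (Q ∩ F ⁻¹' {y}) x) (S i)) :
    ∃ ε > 0, ∃ O : Fin 3 → Set α, (∀ i, IsOpen (O i)) ∧ (∀ i j, i ≠ j → Disjoint (O i) (O j)) ∧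
      (∀ i, Disjoint (O i) (S i)) ∧ Q ∩ F ⁻¹' Metric.ball y ε ⊆ ⋃ i, O i := by
  have hKc : IsCompact (Q ∩ F ⁻¹' {y}) := hQ.inter_right (isClosed_singleton.preimage hF)
  have : CompactSpace ↥(Q ∩ F ⁻¹' {y}) := isCompact_iff_compactSpace.mp hKc
  obtain ⟨c, hc, hcS⟩ := exists_continuous_avoiding
    (K := ↥(Q ∩ F ⁻¹' {y})) (fun i => (↑) ⁻¹' S i)
    (fun i => (hS i).preimage continuous_subtype_val) (fun x => by
      obtain ⟨i, hi⟩ := h x x.2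
      rw [connectedComponentIn_eq_image x.2] at hi
      exact ⟨i, Set.disjoint_left.mpr fun z hz hzi =>
        Set.disjoint_left.mp hi (Set.mem_image_of_mem _ hz) hzi⟩)
  let c' : C(↥(Q ∩ F ⁻¹' {y}), ℝ) :=
    ⟨fun x => ((c x : ℕ) : ℝ), (continuous_of_discreteTopology (f := fun i : Fin 3 =>
      ((i : ℕ) : ℝ))).comp hc⟩
  -- Tietze extension of the colour as a real number; radius `1 / 2` around distinct integers keeps
  -- the `O i` disjoint.
  obtain ⟨g, hg⟩ := c'.exists_extension hKc.isClosed.isClosedEmbedding_subtypeVal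
  let O : Fin 3 → Set α := fun i => {x | |g x - (i : ℕ)| < 1 / 2} ∩ (S i)ᶜ
  have hO : ∀ i, IsOpen (O i) := fun i =>
    (isOpen_lt (by fun_prop) continuous_const).inter (hS i).isOpen_compl
  -- The uncovered part of `Q` has compact image avoiding `y`, hence avoiding a ball around `y`.
  have hrest : IsCompact (F '' (Q \ ⋃ i, O i)) :=
    (hQ.diff (isOpen_iUnion hO)).image hF
  have hy : y ∈ (F '' (Q \ ⋃ i, O i))ᶜ := by
    rintro ⟨x, ⟨hxQ, hx⟩, hxy⟩
    have hxK : x ∈ Q ∩ F ⁻¹' {y} := ⟨hxQ, hxy⟩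
    refine hx (Set.mem_iUnion.mpr ⟨c ⟨x, hxK⟩, ?_, hcS ⟨x, hxK⟩⟩)
    have : g x = ((c ⟨x, hxK⟩ : ℕ) : ℝ) := DFunLike.congr_fun hg ⟨x, hxK⟩
    simp [this]
  obtain ⟨ε, hε, hball⟩ := Metric.isOpen_iff.mp hrest.isClosed.isOpen_compl y hy
  refine ⟨ε, hε, O, hO, fun i j hij => ?_, fun i => ?_, ?_⟩
  · refine Set.disjoint_left.mpr fun x hi hj => hij (Fin.ext ?_)
    have h1 := abs_lt.mp (show |g x - (i : ℕ)| < 1 / 2 from hi.1)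
    have h2 := abs_lt.mp (show |g x - (j : ℕ)| < 1 / 2 from hj.1)
    have h3 : ((i : ℕ) : ℝ) < (j : ℕ) + 1 := by linarith
    have h4 : ((j : ℕ) : ℝ) < (i : ℕ) + 1 := by linarith
    have h5 : (i : ℕ) < j + 1 := by exact_mod_cast h3
    have h6 : (j : ℕ) < i + 1 := by exact_mod_cast h4
    omega
  · exact Set.disjoint_left.mpr fun x hx => hx.2
  · rintro x ⟨hxQ, hx⟩
    by_contra hxO
    exact hball hx ⟨x, ⟨hxQ, hxO⟩, rfl⟩

/-! ### Level sets in the unit square -/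

/-- The left edge, the bottom edge and the union of the other two edges of the unit square,
extended to lines. -/
def squareSide : Fin 3 → Set (ℝ × ℝ) :=
  ![{p | p.1 = 0}, {p | p.2 = 0}, {p | p.1 = 1 ∨ p.2 = 1}]

theorem isClosed_squareSide (i : Fin 3) : IsClosed (squareSide i) := by
  fin_cases i
  · exact isClosed_eq continuous_fst continuous_const
  · exact isClosed_eq continuous_snd continuous_const
  · exact (isClosed_eq continuous_fst continuous_const).union
      (isClosed_eq continuous_snd continuous_const)

/-- In a colouring of the unit square by three colours that omits the `i`-th colour on the `i`-th
side, three different colours occur arbitrarily close to each other. -/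
theorem exists_close_rainbow_points (c : ℝ × ℝ → Fin 3)
    (hc : ∀ p ∈ Set.Icc (0 : ℝ × ℝ) 1, p ∉ squareSide (c p)) {δ : ℝ} (hδ : 0 < δ) :
    ∃ u ∈ Set.Icc (0 : ℝ × ℝ) 1, ∃ v ∈ Set.Icc (0 : ℝ × ℝ) 1, ∃ w ∈ Set.Icc (0 : ℝ × ℝ) 1,
      dist u v < δ ∧ dist v w < δ ∧ dist u w < δ ∧ c u ≠ c v ∧ c v ≠ c w ∧ c u ≠ c w := by
  obtain ⟨m, hm⟩ := exists_nat_one_div_lt hδ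
  let n := m + 1
  have hn : (0 : ℝ) < (n : ℕ) := by positivity
  have hnδ : 1 / (n : ℝ) < δ := by simpa [n] using hm
  let P : ℕ → ℕ → ℝ × ℝ := fun i j => (i / n, j / n)
  have hP : ∀ i ≤ n, ∀ j ≤ n, P i j ∈ Set.Icc (0 : ℝ × ℝ) 1 := by
    intro i hi j hj
    have hi' : (i : ℝ) ≤ n := by exact_mod_cast hi
    have hj' : (j : ℝ) ≤ n := by exact_mod_cast hj
    exact ⟨⟨by positivity, by positivity⟩,
      ⟨(div_le_one hn).mpr hi', (div_le_one hn).mpr hj'⟩⟩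
  have hcoord : ∀ i i' : ℕ, i ≤ i' → i' ≤ i + 1 → dist ((i : ℝ) / n) (i' / n) < δ := by
    intro i i' h1 h2
    have h1' : (i : ℝ) ≤ i' := by exact_mod_cast h1
    have h2' : (i' : ℝ) ≤ i + 1 := by exact_mod_cast h2
    refine lt_of_le_of_lt ?_ hnδ
    rw [dist_comm, Real.dist_eq, ← sub_div, abs_of_nonneg (by apply div_nonneg <;> linarith)]
    gcongr
    linarith
  have hdist : ∀ i i' j j' : ℕ, i ≤ i' → i' ≤ i + 1 → j ≤ j' → j' ≤ j + 1 →
      dist (P i j) (P i' j') < δ := fun i i' j j' h1 h2 h3 h4 =>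
    max_lt (hcoord i i' h1 h2) (hcoord j j' h3 h4)
  have havoid : ∀ i ≤ n, ∀ j ≤ n, ∀ k, P i j ∈ squareSide k → c (P i j) ≠ k := by
    rintro i hi j hj k hk rfl
    exact hc _ (hP i hi j hj) hk
  obtain ⟨i, hi, j, hj, b, hb, h1, h2, h3⟩ := exists_rainbow_triangle (fun i j => c (P i j)) n
    (fun j hj => havoid 0 (Nat.zero_le n) j hj 0 (by simp [squareSide, P]))
    (fun i hi => havoid i hi 0 (Nat.zero_le n) 1 (by simp [squareSide, P]))
    (fun i hi => havoid i hi n le_rfl 2 (by simp [squareSide, P, hn.ne']))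
    (fun j hj => havoid n le_rfl j hj 2 (by simp [squareSide, P, hn.ne']))
  rcases hb with rfl | rfl
  · exact ⟨P i j, hP _ (by omega) _ (by omega), P (i + 1) j, hP _ (by omega) _ (by omega),
      P (i + 1) (j + 1), hP _ (by omega) _ (by omega), hdist _ _ _ _ (by omega) (by omega)
      (by omega) (by omega), hdist _ _ _ _ (by omega) (by omega) (by omega) (by omega),
      hdist _ _ _ _ (by omega) (by omega) (by omega) (by omega), h1, h2, h3⟩
  · exact ⟨P i j, hP _ (by omega) _ (by omega), P i (j + 1), hP _ (by omega) _ (by omega),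
      P (i + 1) (j + 1), hP _ (by omega) _ (by omega), hdist _ _ _ _ (by omega) (by omega)
      (by omega) (by omega), hdist _ _ _ _ (by omega) (by omega) (by omega) (by omega),
      hdist _ _ _ _ (by omega) (by omega) (by omega) (by omega), h1, h2, h3⟩

/-- A preconnected subset of a union of pairwise disjoint open sets lies in one of them. -/
theorem IsPreconnected.eq_index_of_subset_iUnion {α ι : Type*} [TopologicalSpace α] {s : Set α}
    (hs : IsPreconnected s) {O : ι → Set α} (hO : ∀ i, IsOpen (O i))
    (hd : ∀ i j, i ≠ j → Disjoint (O i) (O j)) (hsO : s ⊆ ⋃ i, O i) {i j : ι} {x y : α}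
    (hx : x ∈ s) (hy : y ∈ s) (hxi : x ∈ O i) (hyj : y ∈ O j) : i = j := by
  by_contra hij
  have hsub : s ⊆ O i ∪ ⋃ k : {k // k ≠ i}, O k := by
    intro z hz
    obtain ⟨k, hk⟩ := Set.mem_iUnion.mp (hsO hz)
    by_cases hki : k = i
    · exact Or.inl (hki ▸ hk)
    · exact Or.inr (Set.mem_iUnion.mpr ⟨⟨k, hki⟩, hk⟩)
  have hyi := hs.subset_left_of_subset_union (hO i) (isOpen_iUnion fun k : {k // k ≠ i} => hO k)
    (Set.disjoint_iUnion_right.mpr fun k => hd _ _ (Ne.symm k.2)) hsub ⟨x, hx, hxi⟩ hy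
  exact Set.disjoint_left.mp (hd i j hij) hyi hyj

/-- Every continuous function on the unit square has a level set with a component that meets the
left edge, the bottom edge, and one of the other two edges. -/
theorem exists_level_component_meeting_sides {F : ℝ × ℝ → ℝ} (hF : Continuous F) :
    ∃ y, ∃ x ∈ Set.Icc (0 : ℝ × ℝ) 1 ∩ F ⁻¹' {y}, ∀ i,
      (connectedComponentIn (Set.Icc (0 : ℝ × ℝ) 1 ∩ F ⁻¹' {y}) x ∩ squareSide i).Nonempty := by
  by_contra! hcon
  set Q := Set.Icc (0 : ℝ × ℝ) 1 with hQdef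
  have hQ : IsCompact Q := isCompact_Icc
  have hconv : Convex ℝ Q := convex_Icc 0 1
  have hloc : ∀ y, ∃ ε > 0, ∃ O : Fin 3 → Set (ℝ × ℝ), (∀ i, IsOpen (O i)) ∧
      (∀ i j, i ≠ j → Disjoint (O i) (O j)) ∧ (∀ i, Disjoint (O i) (squareSide i)) ∧
      Q ∩ F ⁻¹' Metric.ball y ε ⊆ ⋃ i, O i := fun y =>
    exists_open_partition_near_level hQ hF squareSide isClosed_squareSide y fun x hx => by
      obtain ⟨i, hi⟩ := hcon y x hx
      exact ⟨i, Set.disjoint_iff_inter_eq_empty.mpr hi⟩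
  choose ε hε O hO hOd hOS hOQ using hloc
  obtain ⟨r, hr, hball⟩ := lebesgue_number_lemma_of_metric (hQ.image hF)
    (c := fun y => Metric.ball y (ε y)) (fun _ => Metric.isOpen_ball)
    (fun y _ => Set.mem_iUnion.mpr ⟨y, Metric.mem_ball_self (hε y)⟩)
  -- Values in one band differ by less than `η`, so the `η`-balls around them lie in a single
  -- `r`-ball.
  let η := r / 2
  have hη : 0 < η := half_pos hr
  let k : ℝ × ℝ → ℤ := fun v => ⌊F v / η⌋
  have hk : ∀ v w, |k v - k w| = 0 → |F v - F w| < η := by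
    intro v w hvw
    have h := Int.abs_sub_lt_one_of_floor_eq_floor (sub_eq_zero.mp (abs_eq_zero.mp hvw))
    rwa [← sub_div, abs_div, abs_of_pos hη, div_lt_one hη] at h
  have hband : ∀ m : ℤ, ∃ y, ∀ v ∈ Q, k v = m →
      Q ∩ F ⁻¹' Metric.ball (F v) η ⊆ ⋃ i, O y i := by
    -- The centre `y` depends on the band alone, so all its points are coloured by the same open
    -- sets. Empty bands get the dummy value `0`.
    intro m
    by_cases hm : ∃ v ∈ Q, k v = m
    · obtain ⟨v, hv, hvm⟩ := hm
      obtain ⟨y, hy⟩ := hball (F v) (Set.mem_image_of_mem F hv)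
      refine ⟨y, fun w hw hwm => subset_trans ?_ (hOQ y)⟩
      rintro z ⟨hzQ, hz⟩
      refine ⟨hzQ, hy ?_⟩
      have h1 := hk w v (by simp [hwm, hvm])
      have h2 : |F z - F w| < η := hz
      calc dist (F z) (F v) ≤ dist (F z) (F w) + dist (F w) (F v) := dist_triangle _ _ _
        _ < η + η := add_lt_add h2 h1
        _ = r := add_halves r
    · exact ⟨0, fun v hv hvm => (hm ⟨v, hv, hvm⟩).elim⟩
  choose Y hY using hband
  have hcol : ∀ v, ∃ i, v ∈ Q → v ∈ O (Y (k v)) i := by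
    intro v
    by_cases hv : v ∈ Q
    · obtain ⟨i, hi⟩ := Set.mem_iUnion.mp (hY (k v) v hv rfl ⟨hv, Metric.mem_ball_self hη⟩)
      exact ⟨i, fun _ => hi⟩
    · exact ⟨0, fun h => (hv h).elim⟩
  choose c hc using hcol
  obtain ⟨δ, hδ, hunif⟩ := Metric.uniformContinuousOn_iff.mp
    (hQ.uniformContinuousOn_of_continuous hF.continuousOn) η hη
  have hclose : ∀ u ∈ Q, ∀ v ∈ Q, dist u v < δ → |k u - k v| ≤ 1 := by
    intro u hu v hv huv
    have h := hunif u hu v hv huv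
    have h' : |F u / η - F v / η| < 1 := by
      rwa [← sub_div, abs_div, abs_of_pos hη, div_lt_one hη]
    obtain ⟨h1, h2⟩ := abs_lt.mp h'
    have h3 := Int.floor_le (F u / η)
    have h4 := Int.lt_floor_add_one (F u / η)
    have h5 := Int.floor_le (F v / η)
    have h6 := Int.lt_floor_add_one (F v / η)
    have h7 : ((k u : ℤ) : ℝ) < k v + 2 := by simp only [k]; linarith
    have h8 : ((k v : ℤ) : ℝ) < k u + 2 := by simp only [k]; linarith
    have h9 : k u < k v + 2 := by exact_mod_cast h7
    have h10 : k v < k u + 2 := by exact_mod_cast h8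
    rw [abs_le]
    omega
  have hsame : ∀ u ∈ Q, ∀ v ∈ Q, dist u v < δ → k u = k v → c u = c v := by
    intro u hu v hv huv huk
    -- A convex piece of `Q` on which `F` stays within `η` of `F u` cannot pass between the disjoint
    -- open sets.
    have hpre : IsPreconnected (Metric.ball u δ ∩ Q) :=
      ((convex_ball u δ).inter hconv).isPreconnected
    have hsub : Metric.ball u δ ∩ Q ⊆ ⋃ i, O (Y (k u)) i := by
      rintro z ⟨hz, hzQ⟩
      exact hY (k u) u hu rfl ⟨hzQ, hunif z hzQ u hu hz⟩
    exact hpre.eq_index_of_subset_iUnion (hO _) (hOd _) hsub ⟨Metric.mem_ball_self hδ, hu⟩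
      ⟨by rwa [Metric.mem_ball, dist_comm], hv⟩ (hc u hu) (huk ▸ hc v hv)
  obtain ⟨u, hu, v, hv, w, hw, huv, hvw, huw, h1, h2, h3⟩ := exists_close_rainbow_points c
    (fun p hp => Set.disjoint_left.mp (hOS _ _) (hc p hp)) hδ
  have e1 := abs_le.mp (hclose u hu v hv huv)
  have e2 := abs_le.mp (hclose v hv w hw hvw)
  have e3 := abs_le.mp (hclose u hu w hw huw)
  have n1 : k u ≠ k v := fun h => h1 (hsame u hu v hv huv h)
  have n2 : k v ≠ k w := fun h => h2 (hsame v hv w hw hvw h)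
  have n3 : k u ≠ k w := fun h => h3 (hsame u hu w hw huw h)
  -- Three integers pairwise at most `1` apart cannot be distinct.
  omega

/-! ### Passing to the metric space and its Reeb graph -/

/-- The image of the unit square under a continuous injection contains no small set meeting the
images of all three sides. -/
theorem exists_lower_bound_ediam_of_meets_sides {X : Type*} [MetricSpace X] {p : ℝ × ℝ → X}
    (hp : Continuous p) (hinj : Function.Injective p) :
    ∃ b : ℝ, 0 < b ∧ ∀ C : Set X,
      (∀ i, ∃ z ∈ Set.Icc (0 : ℝ × ℝ) 1 ∩ squareSide i, p z ∈ C) →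
        ENNReal.ofReal b ≤ Metric.ediam C := by
  let T : Fin 3 → Set (ℝ × ℝ) := fun i => Set.Icc 0 1 ∩ squareSide i
  have hT : ∀ i, IsCompact (T i) := fun i => isCompact_Icc.inter_right (isClosed_squareSide i)
  -- Two of the three distances suffice: if both vanish, injectivity makes all three points equal.
  let D : (Fin 3 → ℝ × ℝ) → ℝ := fun z => max (dist (p (z 0)) (p (z 1))) (dist (p (z 1)) (p (z 2)))
  have hD : Continuous D := by fun_prop
  have hne : (Set.univ.pi T).Nonempty := by
    refine ⟨![(0, 0), (0, 0), (1, 1)], fun i _ => ?_⟩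
    fin_cases i <;> simp [T, squareSide, Prod.le_def]
  obtain ⟨z, hz, hmin⟩ := (isCompact_univ_pi hT).exists_isMinOn hne hD.continuousOn
  refine ⟨D z, ?_, fun C hC => ?_⟩
  · by_contra hle
    have h1 : p (z 0) = p (z 1) :=
      dist_le_zero.mp ((le_max_left _ _).trans (not_lt.mp hle))
    have h2 : p (z 1) = p (z 2) :=
      dist_le_zero.mp ((le_max_right _ _).trans (not_lt.mp hle))
    have hz0 := (hz 0 trivial).2
    have hz1 := (hz 1 trivial).2
    have hz2 := (hz 2 trivial).2
    rw [hinj h1] at hz0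
    rw [← hinj h2] at hz2
    simp [squareSide] at hz0 hz1 hz2
    rw [hz0, hz1] at hz2
    norm_num at hz2
  · choose w hw hwC using hC
    have hle : D z ≤ D w := hmin (fun i _ => hw i)
    refine (ENNReal.ofReal_le_ofReal hle).trans ?_
    rw [ENNReal.ofReal_max, ← edist_dist, ← edist_dist]
    exact max_le (Metric.edist_le_ediam_of_mem (hwC 0) (hwC 1))
      (Metric.edist_le_ediam_of_mem (hwC 1) (hwC 2))

/-- A space containing a plane has a uniform lower bound for the diameter of the largest contour
of a continuous function. -/
theorem ContainsPlane.exists_large_contour {X : Type*} [MetricSpace X] (hX : ContainsPlane X) :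
    ∃ b : ℝ, 0 < b ∧ ∀ f : X → ℝ, Continuous f →
      ∃ C : Set X, IsContour f C ∧ ENNReal.ofReal b ≤ Metric.ediam C := by
  obtain ⟨U, ⟨h⟩⟩ := hX
  let p : ℝ × ℝ → X := fun z => h (!₂[z.1, z.2])
  have hp : Continuous p := by
    refine continuous_subtype_val.comp (h.continuous.comp ?_)
    refine (PiLp.continuous_toLp 2 _).comp (continuous_pi fun i => ?_)
    fin_cases i
    · exact continuous_fst
    · exact continuous_snd
  have hinj : Function.Injective p := by
    intro z w hzw
    have hzw' := h.injective (Subtype.ext hzw)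
    have h0 := congrArg (fun v : EuclideanSpace ℝ (Fin 2) => v 0) hzw'
    have h1 := congrArg (fun v : EuclideanSpace ℝ (Fin 2) => v 1) hzw'
    exact Prod.ext (by simpa using h0) (by simpa using h1)
  obtain ⟨b, hb, hbC⟩ := exists_lower_bound_ediam_of_meets_sides hp hinj
  refine ⟨b, hb, fun f hf => ?_⟩
  obtain ⟨y, x, hx, hmeet⟩ := exists_level_component_meeting_sides (hf.comp hp)
  refine ⟨connectedComponentIn (f ⁻¹' {y}) (p x), ⟨y, p x, hx.2, rfl⟩, hbC _ fun i => ?_⟩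
  obtain ⟨z, hz, hzi⟩ := hmeet i
  have hsub := connectedComponentIn_subset (Set.Icc (0 : ℝ × ℝ) 1 ∩ (f ∘ p) ⁻¹' {y}) x
  refine ⟨z, ⟨(hsub hz).1, hzi⟩, ?_⟩
  refine (isPreconnected_connectedComponentIn.image p hp.continuousOn).subset_connectedComponentIn
    (Set.mem_image_of_mem p (mem_connectedComponentIn hx)) ?_ (Set.mem_image_of_mem p hz)
  rintro _ ⟨w, hw, rfl⟩
  exact (hsub hw).2

/-- The diameter of a contour bounds the distortion of the Reeb quotient map from below. -/
theorem IsContour.ediam_le_distortion {X Y : Type*} [PseudoMetricSpace X] {f : X → Y}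
    {C : Set X} (hC : IsContour f C) [PseudoMetricSpace (ReebGraph f)] :
    Metric.ediam C ≤ distortion (reebMap f) := by
  refine Metric.ediam_le fun x hx x' hx' => ?_
  have heq : reebMap f x = reebMap f x' := Quotient.sound ⟨C, hC, hx, hx'⟩
  refine le_trans ?_ (le_iSup₂ (f := fun x x' : X =>
    ENNReal.ofReal |dist x x' - dist (reebMap f x) (reebMap f x')|) x x')
  simp [heq, edist_dist]

/-- A linear copy of the plane is squeezed into a ball inside a chart target and pulled back to `X`.
-/
theorem containsPlane_of_chartedSpace {X : Type*} [TopologicalSpace X] {n : ℕ} (hn : 2 ≤ n)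
    [Nonempty X] [ChartedSpace (EuclideanSpace ℝ (Fin n)) X] : ContainsPlane X := by
  obtain ⟨L, hL⟩ : ∃ L : EuclideanSpace ℝ (Fin 2) →ₗ[ℝ] EuclideanSpace ℝ (Fin n),
      Function.Injective L :=
    finrank_le_iff_exists_linearMap.mp (by simpa using hn)
  let x : X := Classical.arbitrary X
  let e := chartAt (EuclideanSpace ℝ (Fin n)) x
  obtain ⟨r, hr, hball⟩ := Metric.isOpen_iff.mp e.open_target (e x)
    (e.map_source (mem_chart_source _ x))
  let g := (OpenPartialHomeomorph.univBall (e x) r).trans e.symm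
  have hg : g.source = Set.univ := by
    refine Set.eq_univ_of_forall fun y => ?_
    have hy : y ∈ (OpenPartialHomeomorph.univBall (e x) r).source := by simp
    rw [OpenPartialHomeomorph.trans_source]
    refine ⟨hy, hball ?_⟩
    rw [← OpenPartialHomeomorph.univBall_target _ hr]
    exact (OpenPartialHomeomorph.univBall (e x) r).map_source hy
  exact ⟨_, ⟨((g.isOpenEmbedding hg).isEmbedding.comp
    (LinearMap.isClosedEmbedding_of_injective (LinearMap.ker_eq_bot.mpr hL)).isEmbedding).toHomeomorph⟩⟩

theorem proposition5p8 {X : Type*} [MetricSpace X] :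
    (ContainsPlane X →
      ∃ b : ℝ, 0 < b ∧ ∀ f : X → ℝ, Continuous f →
        (∃ C : Set X, IsContour f C ∧ ENNReal.ofReal b ≤ Metric.ediam C) ∧
        -- for whatever metric, or just pseudometric, the Reeb graph is given
        (∀ [PseudoMetricSpace (ReebGraph f)], ENNReal.ofReal b ≤ distortion (reebMap f))) ∧
    -- the example: nonempty manifolds of dimension at least two
    (∀ n : ℕ, 2 ≤ n → ∀ [Nonempty X] [ChartedSpace (EuclideanSpace ℝ (Fin n)) X],
      ContainsPlane X) := by
  refine ⟨fun hX => ?_, fun n hn _ _ => containsPlane_of_chartedSpace hn⟩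
  obtain ⟨b, hb, h⟩ := hX.exists_large_contour
  refine ⟨b, hb, fun f hf => ?_⟩
  obtain ⟨C, hC, hbC⟩ := h f hf
  exact ⟨⟨C, hC, hbC⟩, fun {_} => hbC.trans hC.ediam_le_distortion⟩
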